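/- Consider $\mathcal{ALCQPIH}_{R^+}$-concepts over countable sets of concept names (non-empty) and role names: they are built from concept names by $\neg,\sqcap,\sqcup$, $\forall R.C$, $\exists R.C$, $\geqslant nR.C$, $\leqslant nR.C$ ($n\ge 0$) and the part restrictions $MrR.C$, $WrR.C$ ($r\in\mathbb Q\cap(0,1)$); roles are role names and their inverses, and roles in number and part restrictions are simple (no sub-role is transitive) with respect to the role hierarchy $\sqsubseteq^+$. Let $\sim C$ be the negation normal form (NNF) of $\neg C$, and $clos(D)$ the smallest set containing $D$ and closed under sub-concepts and $\sim$. A completion tree for $D$ is a finite tree $\mathbf T$ whose nodes $x$ carry finite sets $\mathcal L(x)$ of concepts from $clos(D)$ (or concepts $\forall R.C$ with $R$ transitive, $R\sqsubseteq^+S$, $\forall S.C\in clos(D)$), whose edges carry finite sets of roles occurring in $D$ or inverse to such roles, and whose root label contains $D$. A node $y$ is an $R$-neighbour of $x$ if $y$ is a successor of $x$ with some $S\sqsubseteq^+R$ in the label of the edge $\langle x,y\rangle$, or $x$ is a successor of $y$ with some $S\sqsubseteq^+\mathsf{Inv}(R)$ in the label of $\langle y,x\rangle$; $R^{\mathbf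 T}(x)$ is the set of $R$-neighbours of $x$ and $R^{\mathbf T}(x,C)$ the set of those whose label contains $C$. A part restriction in $\mathcal L(x)$ is $\mathbf T$-satisfied at $x$ if it causes no clash there, i.e. $\sharp R^{\mathbf T}(x,C)>r\cdot\sharp R^{\mathbf T}(x)$ for $MrR.C$, and $\sharp R^{\mathbf T}(x,\sim C)\le r\cdot\sharp R^{\mathbf T}(x)$ for $WrR.C$. The non-generating rules are the $\sqcap$-, $\sqcup$-, $\forall$-, $\forall_+$-, choose- and $\leqslant$-rule of the tableau algorithm (with pair-wise blocking). For a set $P$ of part restrictions in $\mathcal L(x)$ and a set $G$ of concepts of the forms $\exists R.C$, $\geqslant nR.C$ in $\mathcal L(x)$, say that a completion tree $\mathbf T'$ for $D$ satisfies $(P,G)$ at $x$ over $\mathbf T$ if $\mathbf T'$ differs from $\mathbf T$ at most in the proper descendants of $x$; at $x$ and at all its descendants in $\mathbf T'$ no non-generating rule is applicable, no label contains both some $C$ and $\neg C$, and no concept $\leqslant nR.C$ of a label is violated; all members of $P$ are $\mathbf T'$-satisfied at $x$; and all members of $G$ are satisfied at $x$, i.e. $\sharp R^{\mathbf T'}(x,C)\ge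 1$, respectively $\ge n$. Call $(P,G)$ simultaneously satisfiable at $x$ if such a $\mathbf T'$ exists. **Lemma.** There is a computable function which assigns to the label $\mathcal L(x)$ of a node $x$ and, if $x$ is a successor of a node $u$, to the label $\mathcal L(u)$, a natural number $BAN_x$ such that for every role hierarchy, every concept $D$ in NNF, every completion tree $\mathbf T$ for $D$ and every node $x$ of $\mathbf T$ to which no non-generating rule is applicable: 1. $1\le BAN_x\le (2n_0)^{2n_0}\cdot 2^{4n_0^2+3n_0}$, where $n_0$ is the length of $D$ (the number of its symbols, with numbers written in binary); 2. for every set $P$ of part restrictions in $\mathcal L(x)$ and every set $G$ of concepts of the forms $\exists R.C$, $\geqslant nR.C$ in $\mathcal L(x)$ such that $(P,G)$ is simultaneously satisfiable at $x$, there is a completion tree $\mathbf T'$ that satisfies $(P,G)$ at $x$ over $\mathbf T$ and in which, for every role $R$ at the uppermost level of a part restriction in $P$, the number of $R$-neighbours of $x$ does not exceed $BAN_x$. -/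

import Mathlib

/-- Roles: role names and their inverses. -/
inductive Role (ρ : Type*) where
  | name (R : ρ)
  | inv (R : ρ)

namespace Role

variable {ρ : Type*}

/-- The function `Inv`, so that `Inv (Inv R) = R`. -/
def Inv : Role ρ → Role ρ
  | name R => inv R
  | inv R => name R

/-- The underlying role name. -/
def base : Role ρ → ρ
  | name R => R
  | inv R => R

/-- Number of symbols: a role name is one symbol, the inverse sign is another one. -/
def length : Role ρ → ℕ
  | name _ => 1
  | inv _ => 2

/-- A role as a word of natural numbers. -/
def code [Encodable ρ] : Role ρ → List ℕ
  | name R => [0, Encodable.encode R]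
  | inv R => [1, Encodable.encode R]

end Role

/-- Transitive role names and role inclusion axioms. -/
structure RoleBox (ρ : Type*) where
  trans : Set ρ
  incl : Role ρ → Role ρ → Prop

namespace RoleBox

variable {ρ : Type*} (H : RoleBox ρ)

/-- The role hierarchy `⊑⁺`: the reflexive and transitive closure of the inclusion axioms
together with their inverted forms. -/
def Sub : Role ρ → Role ρ → Prop :=
  Relation.ReflTransGen fun R S => H.incl R S ∨ H.incl R.Inv S.Inv

/-- A role is transitive if it is a transitive role name or the inverse of one. -/
def Trans (R : Role ρ) : Prop := R.base ∈ H.trans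

/-- A role is simple if neither it nor any of its sub-roles is transitive. -/
def Simple (R : Role ρ) : Prop := ∀ S, H.Sub S R → ¬ H.Trans S

end RoleBox

/-- Concepts over concept names `α` and role names `ρ`. `more r R C` is the part restriction
`M r R.C` and `weak r R C` is the part restriction `W r R.C`. -/
inductive DLConcept (α ρ : Type*) where
  | atom (A : α)
  | neg (C : DLConcept α ρ)
  | and (C E : DLConcept α ρ)
  | or (C E : DLConcept α ρ)
  | all (R : Role ρ) (C : DLConcept α ρ)
  | ex (R : Role ρ) (C : DLConcept α ρ)
  | atLeast (n : ℕ) (R : Role ρ) (C : DLConcept α ρ)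
  | atMost (n : ℕ) (R : Role ρ) (C : DLConcept α ρ)
  | more (r : ℚ) (R : Role ρ) (C : DLConcept α ρ)
  | weak (r : ℚ) (R : Role ρ) (C : DLConcept α ρ)

namespace DLConcept

variable {α ρ : Type*}

/-- Syntactic side conditions: number and part restrictions use simple roles only, and the
rational number in a part restriction lies strictly between `0` and `1`. -/
def WF (H : RoleBox ρ) : DLConcept α ρ → Prop
  | atom _ => True
  | neg C => C.WF H
  | and C E => C.WF H ∧ E.WF H
  | or C E => C.WF H ∧ E.WF H
  | all _ C => C.WF H
  | ex _ C => C.WF H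
  | atLeast _ R C => H.Simple R ∧ C.WF H
  | atMost _ R C => H.Simple R ∧ C.WF H
  | more r R C => 0 < r ∧ r < 1 ∧ H.Simple R ∧ C.WF H
  | weak r R C => 0 < r ∧ r < 1 ∧ H.Simple R ∧ C.WF H

/-- Negation normal form: negation occurs only in front of concept names. -/
def IsNNF : DLConcept α ρ → Prop
  | atom _ => True
  | neg (atom _) => True
  | neg _ => False
  | and C E => C.IsNNF ∧ E.IsNNF
  | or C E => C.IsNNF ∧ E.IsNNF
  | all _ C => C.IsNNF
  | ex _ C => C.IsNNF
  | atLeast _ _ C => C.IsNNF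
  | atMost _ _ C => C.IsNNF
  | more _ _ C => C.IsNNF
  | weak _ _ C => C.IsNNF

/-- `nnf true C` is the negation normal form of `C`, and `nnf false C` that of `¬ C`.
The negation of `≥ 0 R.C` is the contradiction `A ⊓ ¬ A` for a fixed concept name `A`. -/
def nnf [Inhabited α] : Bool → DLConcept α ρ → DLConcept α ρ
  | true, atom A => atom A
  | false, atom A => neg (atom A)
  | b, neg C => nnf (!b) C
  | true, and C E => and (nnf true C) (nnf true E)
  | false, and C E => or (nnf false C) (nnf false E)
  | true, or C E => or (nnf true C) (nnf true E)
  | false, or C E => and (nnf false C) (nnf false E)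
  | true, all R C => all R (nnf true C)
  | false, all R C => ex R (nnf false C)
  | true, ex R C => ex R (nnf true C)
  | false, ex R C => all R (nnf false C)
  | true, atLeast n R C => atLeast n R (nnf true C)
  | false, atLeast 0 _ _ => and (atom default) (neg (atom default))
  | false, atLeast (n + 1) R C => atMost n R (nnf true C)
  | true, atMost n R C => atMost n R (nnf true C)
  | false, atMost n R C => atLeast (n + 1) R (nnf true C)
  | true, more r R C => more r R (nnf true C)
  | false, more r R C => weak r R (nnf false C)
  | true, weak r R C => weak r R (nnf true C)
  | false, weak r R C => more r R (nnf false C)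

/-- `∼ C`, the negation normal form of `¬ C`. -/
def compl [Inhabited α] (C : DLConcept α ρ) : DLConcept α ρ := nnf false C

/-- The immediate sub-concepts of a concept. -/
def immSub : DLConcept α ρ → Set (DLConcept α ρ)
  | atom _ => ∅
  | neg C => {C}
  | and C E => {C, E}
  | or C E => {C, E}
  | all _ C => {C}
  | ex _ C => {C}
  | atLeast _ _ C => {C}
  | atMost _ _ C => {C}
  | more _ _ C => {C}
  | weak _ _ C => {C}

/-- `Clos D C`: the concept `C` belongs to `clos(D)`, the smallest set of concepts that contains
`D` and is closed under sub-concepts and under `∼`. -/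
inductive Clos [Inhabited α] (D : DLConcept α ρ) : DLConcept α ρ → Prop
  | self : Clos D D
  | sub {C E : DLConcept α ρ} : Clos D C → E ∈ C.immSub → Clos D E
  | compl {C : DLConcept α ρ} : Clos D C → Clos D C.compl

/-- The concepts that may label nodes: those of `clos(D)` and the concepts `∀ R.C` with `R`
transitive, `R ⊑⁺ S` and `∀ S.C` in `clos(D)`, which the rule for transitive roles adds. -/
def LabelConcept [Inhabited α] (H : RoleBox ρ) (D C : DLConcept α ρ) : Prop :=
  Clos D C ∨ ∃ R S E, C = all R E ∧ Clos D (all S E) ∧ H.Sub R S ∧ H.Trans R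

/-- The roles that occur in a concept. -/
def occ : DLConcept α ρ → Set (Role ρ)
  | atom _ => ∅
  | neg C => C.occ
  | and C E => C.occ ∪ E.occ
  | or C E => C.occ ∪ E.occ
  | all R C => insert R C.occ
  | ex R C => insert R C.occ
  | atLeast _ R C => insert R C.occ
  | atMost _ R C => insert R C.occ
  | more _ R C => insert R C.occ
  | weak _ R C => insert R C.occ

/-- `R_D`: the roles that occur in a concept, and their inverses. -/
def roles (D : DLConcept α ρ) : Set (Role ρ) := {R | R ∈ D.occ ∨ R.Inv ∈ D.occ}

/-- The number of binary digits of a natural number (`0` has one digit). -/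
def digits (n : ℕ) : ℕ := max 1 n.size

/-- The length of a concept: the number of its symbols, numbers being written in binary and
rational numbers as fractions in lowest terms. Dots, parentheses and fraction bars are not
counted. -/
def length : DLConcept α ρ → ℕ
  | atom _ => 1
  | neg C => 1 + C.length
  | and C E => 1 + C.length + E.length
  | or C E => 1 + C.length + E.length
  | all R C => 1 + R.length + C.length
  | ex R C => 1 + R.length + C.length
  | atLeast n R C => 1 + digits n + R.length + C.length
  | atMost n R C => 1 + digits n + R.length + C.length
  | more r R C => 1 + digits r.num.natAbs + digits r.den + R.length + C.length
  | weak r R C => 1 + digits r.num.natAbs + digits r.den + R.length + C.length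

/-- A concept as a word of natural numbers, in prefix notation. -/
def code [Encodable α] [Encodable ρ] : DLConcept α ρ → List ℕ
  | atom A => [0, Encodable.encode A]
  | neg C => 1 :: C.code
  | and C E => 2 :: (C.code ++ E.code)
  | or C E => 3 :: (C.code ++ E.code)
  | all R C => 4 :: (R.code ++ C.code)
  | ex R C => 5 :: (R.code ++ C.code)
  | atLeast n R C => 6 :: n :: (R.code ++ C.code)
  | atMost n R C => 7 :: n :: (R.code ++ C.code)
  | more r R C => 8 :: r.num.natAbs :: r.den :: (R.code ++ C.code)
  | weak r R C => 9 :: r.num.natAbs :: r.den :: (R.code ++ C.code)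

/-- `C.IsPartOn R`: `C` is a part restriction whose uppermost role is `R`. -/
def IsPartOn (R : Role ρ) (C : DLConcept α ρ) : Prop :=
  ∃ r E, C = more r R E ∨ C = weak r R E

/-- Part restrictions. -/
def IsPart (C : DLConcept α ρ) : Prop := ∃ R, C.IsPartOn R

/-- The concepts `∃ R.C` and `≥ n R.C`. -/
def IsAtLeast (C : DLConcept α ρ) : Prop :=
  (∃ R E, C = ex R E) ∨ ∃ n R E, C = atLeast n R E

/-- `Box R C F`: the concept `F` is `⊠ R.C`, where `⊠` is one of `∃`, `≥ n`, `≤ n`, `M r`,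
`W r`. -/
def Box (R : Role ρ) (C F : DLConcept α ρ) : Prop :=
  F = ex R C ∨ (∃ n, F = atLeast n R C ∨ F = atMost n R C) ∨
    ∃ r, F = more r R C ∨ F = weak r R C

end DLConcept

/-- A finite tree whose nodes and edges are labelled with finite sets of concepts and of roles.
Nodes are addresses: `[]` is the root, and the successors of the node `x` are the nodes `i :: x`.
`edge (i :: x)` is the label of the edge from `x` to `i :: x`. -/
structure LTree (α ρ : Type*) where
  nodes : Finset (List ℕ)
  root_mem : [] ∈ nodes
  pred_mem : ∀ i x, i :: x ∈ nodes → x ∈ nodes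
  label : List ℕ → Finset (DLConcept α ρ)
  edge : List ℕ → Finset (Role ρ)

namespace LTree

variable {α ρ : Type*}

/-- The label of the predecessor of a node, if the node is not the root. -/
def predLabel (T : LTree α ρ) : List ℕ → Option (Finset (DLConcept α ρ))
  | [] => none
  | _ :: u => some (T.label u)

/-- Completion trees for `D`: nodes are labelled with concepts that arise from `D`, edges with
roles in `R_D`, and the root is labelled with `D`. -/
def IsCompletionTree [Inhabited α] (H : RoleBox ρ) (D : DLConcept α ρ) (T : LTree α ρ) : Prop :=
  D ∈ T.label [] ∧
  (∀ x ∈ T.nodes, ∀ C ∈ T.label x, DLConcept.LabelConcept H D C) ∧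
  ∀ i x, i :: x ∈ T.nodes → ∀ R ∈ T.edge (i :: x), R ∈ D.roles

/-- `y` is a successor of `x`. -/
def IsSucc (T : LTree α ρ) (x y : List ℕ) : Prop := y ∈ T.nodes ∧ ∃ i, y = i :: x

/-- `y` is an `R`-successor of `x`. -/
def IsRSucc (H : RoleBox ρ) (T : LTree α ρ) (R : Role ρ) (x y : List ℕ) : Prop :=
  T.IsSucc x y ∧ ∃ S ∈ T.edge y, H.Sub S R

open Classical in
/-- `R^T(x)`, the set of `R`-neighbours of `x`. -/
noncomputable def nbrs (H : RoleBox ρ) (T : LTree α ρ) (R : Role ρ) (x : List ℕ) :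
    Finset (List ℕ) :=
  T.nodes.filter fun y => T.IsRSucc H R x y ∨ T.IsRSucc H R.Inv y x

open Classical in
/-- `R^T(x, C)`, the set of `R`-neighbours of `x` labelled with `C`. -/
noncomputable def nbrsWith (H : RoleBox ρ) (T : LTree α ρ) (R : Role ρ) (x : List ℕ)
    (C : DLConcept α ρ) : Finset (List ℕ) :=
  (T.nbrs H R x).filter fun y => C ∈ T.label y

/-- The roles labelling the connection from `x` to its neighbour `y`, read from `x` to `y`:
if `y` is the predecessor of `x`, these are the inverses of the roles labelling the edge. -/
def link (T : LTree α ρ) (x y : List ℕ) : Set (Role ρ) :=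
  {S | (T.IsSucc x y ∧ S ∈ T.edge y) ∨ (T.IsSucc y x ∧ S.Inv ∈ T.edge x)}

/-- The node `x` and a proper ancestor `y` of it carry the same label, so do their predecessors,
and so do the edges leading to them. -/
def PairMatch (T : LTree α ρ) : List ℕ → Prop
  | [] => False
  | i :: u => ∃ j v, (j :: v) <:+ u ∧ T.label (i :: u) = T.label (j :: v) ∧
      T.label u = T.label v ∧ T.edge (i :: u) = T.edge (j :: v)

/-- Blocked nodes (pair-wise blocking). A node is indirectly blocked if its predecessor is
blocked or if the edge leading to it has the empty label; it is directly blocked if no ancestor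
is blocked and it matches a proper ancestor. As all descendants of a blocked node are blocked,
the condition on the ancestors can be dropped in the disjunction. -/
def Blocked (T : LTree α ρ) : List ℕ → Prop
  | [] => False
  | i :: u => T.Blocked u ∨ T.edge (i :: u) = ∅ ∨ T.PairMatch (i :: u)

/-- Indirectly blocked nodes. -/
def IndirectlyBlocked (T : LTree α ρ) : List ℕ → Prop
  | [] => False
  | i :: u => T.Blocked u ∨ T.edge (i :: u) = ∅

section Rules

variable (H : RoleBox ρ) (T : LTree α ρ) (x : List ℕ)

/-- The `⊓`-rule is applicable to `x`. -/
def AndApplicable : Prop :=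
  ¬ T.IndirectlyBlocked x ∧ ∃ C E, DLConcept.and C E ∈ T.label x ∧
    ¬ (C ∈ T.label x ∧ E ∈ T.label x)

/-- The `⊔`-rule is applicable to `x`. -/
def OrApplicable : Prop :=
  ¬ T.IndirectlyBlocked x ∧ ∃ C E, DLConcept.or C E ∈ T.label x ∧
    C ∉ T.label x ∧ E ∉ T.label x

/-- The `∀`-rule is applicable to `x`. -/
def AllApplicable : Prop :=
  ¬ T.IndirectlyBlocked x ∧ ∃ R C, DLConcept.all R C ∈ T.label x ∧
    ∃ y ∈ T.nbrs H R x, C ∉ T.label y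

/-- The `∀₊`-rule is applicable to `x`. -/
def AllTransApplicable : Prop :=
  ¬ T.IndirectlyBlocked x ∧ ∃ R S C, DLConcept.all S C ∈ T.label x ∧ H.Trans R ∧ H.Sub R S ∧
    ∃ y ∈ T.nbrs H R x, DLConcept.all R C ∉ T.label y

/-- The choose-rule is applicable to `x`. -/
def ChooseApplicable [Inhabited α] : Prop :=
  ¬ T.IndirectlyBlocked x ∧ ∃ R C, (∃ F ∈ T.label x, DLConcept.Box R C F) ∧
    ∃ y ∈ T.nbrs H R x, C ∉ T.label y ∧ C.compl ∉ T.label y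

/-- The `≤`-rule is applicable to `x`. -/
def AtMostApplicable : Prop :=
  ¬ T.IndirectlyBlocked x ∧ ∃ n R C, DLConcept.atMost n R C ∈ T.label x ∧
    n < (T.nbrsWith H R x C).card ∧
    ∃ y ∈ T.nbrsWith H R x C, ∃ z ∈ T.nbrsWith H R x C,
      y ≠ z ∧ Disjoint (T.link x y) (T.link x z) ∧ ¬ T.IsSucc y x

/-- No non-generating rule is applicable to `x`. -/
def NonGeneratingDone [Inhabited α] : Prop :=
  ¬ T.AndApplicable x ∧ ¬ T.OrApplicable x ∧ ¬ T.AllApplicable H x ∧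
    ¬ T.AllTransApplicable H x ∧ ¬ T.ChooseApplicable H x ∧ ¬ T.AtMostApplicable H x

/-- A clash `{C, ¬ C} ⊆ L(x)`. -/
def NegClash : Prop := ∃ C, C ∈ T.label x ∧ DLConcept.neg C ∈ T.label x

/-- A clash with a concept `≤ n R.C` in `L(x)`. -/
def AtMostClash : Prop :=
  ∃ n R C, DLConcept.atMost n R C ∈ T.label x ∧ n < (T.nbrsWith H R x C).card

/-- The part restriction is violated at `x`, i.e. there is a clash with it if it is in `L(x)`. -/
def PartClash [Inhabited α] : DLConcept α ρ → Prop
  | .more r R C => ((T.nbrsWith H R x C).card : ℚ) ≤ r * (T.nbrs H R x).card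
  | .weak r R C => r * (T.nbrs H R x).card < ((T.nbrsWith H R x C.compl).card : ℚ)
  | _ => False

/-- A concept `∃ R.C` or `≥ n R.C` is not yet satisfied at `x`. -/
def AtLeastLacking : DLConcept α ρ → Prop
  | .ex R C => T.nbrsWith H R x C = ∅
  | .atLeast n R C => (T.nbrsWith H R x C).card < n
  | _ => False

end Rules

/-- `T'` coincides with `T` except possibly at the proper descendants of `x`. -/
def AgreeOff (x : List ℕ) (T T' : LTree α ρ) : Prop :=
  ∀ z, (x <:+ z → z = x) →
    (z ∈ T'.nodes ↔ z ∈ T.nodes) ∧ T'.label z = T.label z ∧ T'.edge z = T.edge z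

/-- `T'` is a completion tree for `D` which differs from `T` at most in the proper descendants of
`x`, in which at `x` and below no non-generating rule is applicable and there is neither a clash
`{C, ¬ C}` nor a clash with an at-most restriction, in which all part restrictions in `P` are
`T'`-satisfied at `x` (there is no clash with them), and in which the concepts in `G` (of the
form `∃ R.C` or `≥ n R.C`) are satisfied at `x`. -/
def Satisfies [Inhabited α] (H : RoleBox ρ) (D : DLConcept α ρ) (T : LTree α ρ) (x : List ℕ)
    (P G : Set (DLConcept α ρ)) (T' : LTree α ρ) : Prop :=
  T'.IsCompletionTree H D ∧ AgreeOff x T T' ∧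
  (∀ z ∈ T'.nodes, x <:+ z →
    T'.NonGeneratingDone H z ∧ ¬ T'.NegClash z ∧ ¬ T'.AtMostClash H z) ∧
  (∀ C ∈ P, ¬ T'.PartClash H x C) ∧
  ∀ C ∈ G, ¬ T'.AtLeastLacking H x C

/-- The part restrictions in `P`, together with the concepts in `G`, are simultaneously
satisfiable at the node `x` of `T`. -/
def SimSatisfiable [Inhabited α] (H : RoleBox ρ) (D : DLConcept α ρ) (T : LTree α ρ) (x : List ℕ)
    (P G : Set (DLConcept α ρ)) : Prop :=
  ∃ T', Satisfies H D T x P G T'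

end LTree

/-- A function of a node label and of the optional label of the predecessor is computable if a
computable function yields its value from any enumeration of the labels without repetitions,
concepts being written as words. -/
def LabelComputable {α ρ : Type*} [Encodable α] [Encodable ρ]
    (B : Finset (DLConcept α ρ) → Option (Finset (DLConcept α ρ)) → ℕ) : Prop :=
  ∃ f : List (List ℕ) → Option (List (List ℕ)) → ℕ, Computable₂ f ∧
    (∀ (L : Finset (DLConcept α ρ)) (l : List (DLConcept α ρ)), L.val = (l : Multiset _) →
      B L none = f (l.map DLConcept.code) none) ∧
    ∀ (L M : Finset (DLConcept α ρ)) (l m : List (DLConcept α ρ)), L.val = (l : Multiset _) →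
      M.val = (m : Multiset _) →
      B L (some M) = f (l.map DLConcept.code) (some (m.map DLConcept.code))

/-!
Each concept of `P ∪ G` is an integer linear inequality `∑ y, w y ≥ b` in the contributions `w y` of
the neighbours `y` of `x`, with coefficients bounded by the numbers in the concept. Deleting a
successor of `x`, together with the subtree below it, neither violates an at-most restriction nor
makes a non-generating rule applicable, so it suffices to keep a set of successors that still
satisfies these inequalities, and a minimal such set is small: by the Steinitz lemma the vectors
`w y` can be ordered so that all prefix sums stay close to the segment from `0` to the total sum; if
there are many vectors, two prefixes lie at the same position relative to that segment, and the
block between them can be deleted, since it contributes at most the total sum.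

The Steinitz lemma is proved by choosing the last vector of the ordering and recursing: an extreme
point of the polytope of weights in `[0, 1]` with vanishing weighted sum has few fractional
coordinates, which forces some coordinate to be zero if the total weight is suitably small, and the
vector with weight zero can be put last.
-/

section Steinitz

open Finset Module Filter Topology

variable {E Y : Type*} [NormedAddCommGroup E] [NormedSpace ℝ E]

/-- The polytope of weights in `[0, 1]` on the members of `A`, of total weight `s`, for which the
weighted sum of the vectors `v y` vanishes. Weights vanish off `A`. -/
def balancedWeights (v : Y → E) (A : Finset Y) (s : ℝ) : Set (Y → ℝ) :=
  {l | 0 ≤ l ∧ l ≤ (A : Set Y).indicator 1 ∧ ∑ y ∈ A, l y = s ∧ ∑ y ∈ A, l y • v y = 0}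

variable {v : Y → E} {A : Finset Y} {l : Y → ℝ} {s t : ℝ}

theorem le_one_of_mem_balancedWeights (hl : l ∈ balancedWeights v A s) (y : Y) : l y ≤ 1 :=
  (hl.2.1 y).trans (Set.indicator_le_self' (fun _ _ => zero_le_one) y)

theorem isCompact_balancedWeights : IsCompact (balancedWeights v A s) := by
  have h : balancedWeights v A s = Set.Icc 0 ((A : Set Y).indicator 1) ∩
      ({l | ∑ y ∈ A, l y = s} ∩ {l | ∑ y ∈ A, l y • v y = 0}) := by
    ext l
    simp only [balancedWeights, Set.mem_ofPred_eq, Set.mem_inter_iff, Set.mem_Icc, and_assoc]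
  rw [h]
  exact isCompact_Icc.inter_right <| (isClosed_eq (by fun_prop) (by fun_prop)).inter
    (isClosed_eq (by fun_prop) (by fun_prop))

theorem nonempty_balancedWeights_of_le (h : (balancedWeights v A s).Nonempty) (ht : 0 ≤ t)
    (hts : t ≤ s) : (balancedWeights v A t).Nonempty := by
  obtain ⟨l, h0, h1, hs, hv⟩ := h
  have hc : 0 ≤ t / s := div_nonneg ht (ht.trans hts)
  refine ⟨(t / s) • l, smul_nonneg hc h0, (smul_le_of_le_one_left h0 ?_).trans h1, ?_, ?_⟩
  · exact div_le_one_of_le₀ hts (ht.trans hts)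
  · simp only [Pi.smul_apply, smul_eq_mul, ← mul_sum, hs]
    rcases eq_or_ne s 0 with rfl | hs0
    · simp [le_antisymm hts ht]
    · exact div_mul_cancel₀ t hs0
  · simp only [Pi.smul_apply, smul_assoc, ← smul_sum, hv, smul_zero]

theorem norm_sum_le_of_mem_balancedWeights {Δ : ℝ} (hv : ∀ y ∈ A, ‖v y‖ ≤ Δ)
    (hl : l ∈ balancedWeights v A s) : ‖∑ y ∈ A, v y‖ ≤ (#A - s) * Δ :=
  calc ‖∑ y ∈ A, v y‖ = ‖∑ y ∈ A, (1 - l y) • v y‖ := by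
        simp only [sub_smul, one_smul, sum_sub_distrib, hl.2.2.2, sub_zero]
    _ ≤ ∑ y ∈ A, (1 - l y) * Δ := norm_sum_le_of_le _ fun y hy => by
        have h1 : 0 ≤ 1 - l y := sub_nonneg.2 (le_one_of_mem_balancedWeights hl y)
        rw [norm_smul, Real.norm_of_nonneg h1]
        exact mul_le_mul_of_nonneg_left (hv y hy) h1
    _ = (#A - s) * Δ := by simp [← sum_mul, sum_sub_distrib, hl.2.2.1]

theorem eventually_add_smul_mem_balancedWeights (hl : l ∈ balancedWeights v A s) {g : Y → ℝ}
    (hg : ∀ y ∉ ({y ∈ A | 0 < l y ∧ l y < 1} : Finset Y), g y = 0) (hsum : ∑ y ∈ A, g y = 0)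
    (hv : ∑ y ∈ A, g y • v y = 0) :
    ∀ᶠ t in 𝓝 (0 : ℝ), l + t • g ∈ balancedWeights v A s := by
  have hfrac : ∀ᶠ t in 𝓝 (0 : ℝ), ∀ y ∈ ({y ∈ A | 0 < l y ∧ l y < 1} : Finset Y),
      l y + t * g y ∈ Set.Ioo 0 1 := by
    refine (eventually_all_finset _).2 fun y hy => ?_
    have hlim : Tendsto (fun t : ℝ => l y + t * g y) (𝓝 0) (𝓝 (l y)) :=
      Continuous.tendsto' (by fun_prop) 0 _ (by ring)
    exact hlim.eventually_mem (Ioo_mem_nhds (mem_filter.1 hy).2.1 (mem_filter.1 hy).2.2)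
  filter_upwards [hfrac] with t ht
  have hbox : ∀ y, 0 ≤ (l + t • g) y ∧ (l + t • g) y ≤ (A : Set Y).indicator 1 y := fun y => by
    by_cases hy : y ∈ ({y ∈ A | 0 < l y ∧ l y < 1} : Finset Y)
    · simpa [(mem_filter.1 hy).1] using ⟨(ht y hy).1.le, (ht y hy).2.le⟩
    · simpa [hg y hy] using ⟨hl.1 y, hl.2.1 y⟩
  refine ⟨fun y => (hbox y).1, fun y => (hbox y).2, ?_, ?_⟩
  · simp [sum_add_distrib, ← mul_sum, hl.2.2.1, hsum]
  · simp [add_smul, sum_add_distrib, ← smul_smul, ← smul_sum, hl.2.2.2, hv]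

variable [FiniteDimensional ℝ E]

theorem exists_affine_relation (v : Y → E) {F : Finset Y} (hF : finrank ℝ E + 1 < #F) :
    ∃ g : Y → ℝ, (∀ y ∉ F, g y = 0) ∧ ∑ y ∈ F, g y = 0 ∧ ∑ y ∈ F, g y • v y = 0 ∧ g ≠ 0 := by
  classical
  have hdep : ¬ LinearIndepOn ℝ (fun y => ((1 : ℝ), v y)) (F : Set Y) := fun h => by
    have := h.fintype_card_le_finrank
    rw [finrank_prod, finrank_self] at this
    simp only [coe_sort_coe, Fintype.card_coe] at this
    omega
  rw [linearIndepOn_finset_iff] at hdep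
  push Not at hdep
  obtain ⟨g, hg, y, hy, hgy⟩ := hdep
  have hgF : ∀ z ∈ F, (F : Set Y).indicator g z = g z := fun z hz => by simp [hz]
  refine ⟨(F : Set Y).indicator g, fun z hz => by simp [hz], ?_, ?_, fun h => hgy ?_⟩
  · rw [sum_congr rfl hgF]
    simpa [Prod.fst_sum] using congrArg Prod.fst hg
  · rw [sum_congr rfl fun z hz => by rw [hgF z hz]]
    simpa [Prod.snd_sum] using congrArg Prod.snd hg
  · rw [← hgF y hy, h, Pi.zero_apply]

theorem card_fractional_le_of_mem_extremePoints
    (hl : l ∈ (balancedWeights v A s).extremePoints ℝ) :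
    #{y ∈ A | 0 < l y ∧ l y < 1} ≤ finrank ℝ E + 1 := by
  by_contra! hF
  obtain ⟨g, hgF, hg, hgv, hg0⟩ := exists_affine_relation v hF
  rw [sum_subset (filter_subset _ A) fun y _ => hgF y] at hg
  rw [sum_subset (filter_subset _ A) fun y _ hy => by rw [hgF y hy, zero_smul]] at hgv
  obtain ⟨hlA, hext⟩ := mem_extremePoints_iff_left.1 hl
  have hpos := eventually_add_smul_mem_balancedWeights hlA hgF hg hgv
  have hneg : ∀ᶠ t in 𝓝 (0 : ℝ), l + (-t) • g ∈ balancedWeights v A s :=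
    (continuous_neg.tendsto' (0 : ℝ) 0 neg_zero).eventually hpos
  obtain ⟨t, ⟨hpos, hneg⟩, ht⟩ :=
    (((hpos.and hneg).filter_mono nhdsWithin_le_nhds).and
      (self_mem_nhdsWithin (s := {0}ᶜ))).exists
  have hseg : l ∈ openSegment ℝ (l + t • g) (l + (-t) • g) :=
    ⟨1 / 2, 1 / 2, by norm_num, by norm_num, by norm_num, by module⟩
  have htg : t • g = 0 := by simpa using hext _ hpos _ hneg hseg
  exact (smul_eq_zero.1 htg).elim ht hg0

theorem exists_eq_zero_of_mem_extremePoints (hA : A.Nonempty)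
    (hs : s ≤ max 0 ((#A : ℝ) - (finrank ℝ E + 1)))
    (hl : l ∈ (balancedWeights v A s).extremePoints ℝ) : ∃ y ∈ A, l y = 0 := by
  by_contra! hpos
  obtain ⟨h0, -, hsum, -⟩ := extremePoints_subset hl
  set F : Finset Y := {y ∈ A | 0 < l y ∧ l y < 1}
  have hF : ∑ y ∈ F, (1 - l y) = #A - s := by
    rw [sum_subset (filter_subset _ _) fun y hy hyF => ?_, sum_sub_distrib, hsum]
    · simp
    · have hle := le_one_of_mem_balancedWeights (extremePoints_subset hl) y
      by_contra hne
      exact hyF (mem_filter.2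
        ⟨hy, (h0 y).lt_of_ne' (hpos y hy), hle.lt_of_ne fun h => hne (by rw [h, sub_self])⟩)
  have hFA : (#F : ℝ) ≤ #A := by exact_mod_cast card_le_card (filter_subset _ _)
  have hFd : (#F : ℝ) ≤ finrank ℝ E + 1 := by
    exact_mod_cast card_fractional_le_of_mem_extremePoints hl
  have hApos : (0 : ℝ) < #A := by exact_mod_cast hA.card_pos
  rcases F.eq_empty_or_nonempty with hF0 | hFne
  · rw [hF0, sum_empty] at hF
    exact (hs.trans_lt (max_lt hApos (by linarith))).ne (sub_eq_zero.1 hF.symm).symm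
  · have hlt : ∑ y ∈ F, (1 - l y) < ∑ _y ∈ F, 1 :=
      sum_lt_sum_of_nonempty hFne fun y hy => sub_lt_self _ (mem_filter.1 hy).2.1
    rw [hF, sum_const, nsmul_one, sub_lt_comm] at hlt
    exact (hs.trans (max_le (by linarith) (by linarith))).not_gt hlt

theorem exists_erase_balancedWeights_nonempty [DecidableEq Y] (hA : A.Nonempty)
    (h : ∃ s ≥ (#A : ℝ) - finrank ℝ E, (balancedWeights v A s).Nonempty) :
    ∃ y ∈ A, ∃ s ≥ (#(A.erase y) : ℝ) - finrank ℝ E,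
      (balancedWeights v (A.erase y) s).Nonempty := by
  obtain ⟨s, hs, hne⟩ := h
  set t : ℝ := max 0 (#A - (finrank ℝ E + 1)) with ht
  have hs0 : 0 ≤ s := hne.elim fun l hl => hl.2.2.1 ▸ sum_nonneg fun y _ => hl.1 y
  obtain ⟨l, hl⟩ := isCompact_balancedWeights.extremePoints_nonempty
    (nonempty_balancedWeights_of_le hne (le_max_left _ _) (max_le hs0 (by linarith)) :
      (balancedWeights v A t).Nonempty)
  obtain ⟨y, hy, hly⟩ := exists_eq_zero_of_mem_extremePoints hA ht.le hl
  obtain ⟨h0, h1, hsum, hv⟩ := extremePoints_subset hl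
  refine ⟨y, hy, t, ?_, l, h0, fun z => ?_, ?_, ?_⟩
  · rw [card_erase_of_mem hy, Nat.cast_pred hA.card_pos]
    exact le_max_of_le_right (by linarith)
  · rcases eq_or_ne z y with rfl | hz
    · simp [hly]
    · simpa [Set.indicator, hz] using h1 z
  · rwa [sum_erase _ hly]
  · rwa [sum_erase _ (by rw [hly, zero_smul])]

theorem exists_list_norm_prefix_sum_le_of_balancedWeights {Δ : ℝ} (hΔ : 0 ≤ Δ) (v : Y → E)
    (A : Finset Y) (hv : ∀ y ∈ A, ‖v y‖ ≤ Δ)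
    (h : ∃ s ≥ (#A : ℝ) - finrank ℝ E, (balancedWeights v A s).Nonempty) :
    ∃ l : List Y, A.val = l ∧ ∀ p, p <+: l → ‖(p.map v).sum‖ ≤ finrank ℝ E * Δ := by
  classical
  induction A using Finset.strongInduction with
  | H A ih =>
    have hA : ‖∑ y ∈ A, v y‖ ≤ finrank ℝ E * Δ := by
      obtain ⟨s, hs, l, hl⟩ := h
      exact (norm_sum_le_of_mem_balancedWeights hv hl).trans
        (mul_le_mul_of_nonneg_right (by linarith) hΔ)
    rcases A.eq_empty_or_nonempty with rfl | hne
    · exact ⟨[], rfl, fun p hp => by simpa [List.prefix_nil.1 hp] using hA⟩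
    obtain ⟨y, hy, hs⟩ := exists_erase_balancedWeights_nonempty hne h
    obtain ⟨l, hl, hpre⟩ :=
      ih (A.erase y) (erase_ssubset hy) (fun z hz => hv z (mem_of_mem_erase hz)) hs
    have hval : A.val = (l ++ [y] : List Y) := by
      rw [← insert_erase hy, insert_val_of_notMem (notMem_erase y A), hl, Multiset.cons_coe]
      exact Quot.sound (List.perm_append_singleton y l).symm
    refine ⟨l ++ [y], hval, fun p hp => ?_⟩
    rcases List.prefix_concat_iff.1 hp with rfl | hp
    · have : ∑ y ∈ A, v y = ((l ++ [y]).map v).sum := by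
        rw [Finset.sum, hval, Multiset.map_coe, Multiset.sum_coe]
      rwa [← this]
    · exact hpre p hp

/-- The Steinitz lemma, with the constant `dim E` of Grinberg and Sevastyanov. -/
theorem exists_list_norm_prefix_sum_le {Δ : ℝ} (hΔ : 0 ≤ Δ) (v : Y → E) (A : Finset Y)
    (hv : ∀ y ∈ A, ‖v y‖ ≤ Δ) (h0 : ∑ y ∈ A, v y = 0) :
    ∃ l : List Y, A.val = l ∧ ∀ p, p <+: l → ‖(p.map v).sum‖ ≤ finrank ℝ E * Δ := by
  refine exists_list_norm_prefix_sum_le_of_balancedWeights hΔ v A hv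
    ⟨#A, by simp, (A : Set Y).indicator 1, ?_, le_rfl, ?_, ?_⟩
  · exact Set.indicator_nonneg fun _ _ => zero_le_one
  · rw [sum_congr rfl fun y hy => Set.indicator_of_mem (mem_coe.2 hy) _]
    simp
  · rw [sum_congr rfl fun y hy => by rw [Set.indicator_of_mem (mem_coe.2 hy)]]
    simpa using h0

end Steinitz

section SmallSubset

open Finset

variable {ι Y : Type*} [Fintype ι] {A : Finset Y} {v : Y → ι → ℤ} {Δ : ℕ}

theorem exists_list_abs_prefix_sum_le (hv : ∀ y ∈ A, ∀ i, |v y i| ≤ Δ)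
    (h0 : ∀ i, ∑ y ∈ A, v y i = 0) :
    ∃ l : List Y, A.val = l ∧ ∀ p, p <+: l → ∀ i,
      |(p.map (v · i)).sum| ≤ Fintype.card ι * Δ := by
  let w : Y → ι → ℝ := fun y i => v y i
  have hwv : ∀ y i, w y i = v y i := fun _ _ => rfl
  have hw : ∀ y ∈ A, ‖w y‖ ≤ Δ := fun y hy =>
    (pi_norm_le_iff_of_nonneg Δ.cast_nonneg).2 fun i => by
      rw [Real.norm_eq_abs, hwv]
      exact_mod_cast hv y hy i
  have hw0 : ∑ y ∈ A, w y = 0 := by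
    ext i
    simp only [Finset.sum_apply, Pi.zero_apply, hwv]
    exact_mod_cast h0 i
  obtain ⟨l, hl, hpre⟩ := exists_list_norm_prefix_sum_le Δ.cast_nonneg w A hw hw0
  refine ⟨l, hl, fun p hp i => ?_⟩
  have hsum : (p.map w).sum i = ((p.map (v · i)).sum : ℤ) := by
    clear hp
    induction p with
    | nil => simp
    | cons y p ih => simp [ih, hwv]
  have hnorm := (norm_le_pi_norm _ i).trans (hpre p hp)
  rw [hsum, Real.norm_eq_abs, Module.finrank_fintype_fun_eq_card] at hnorm
  exact_mod_cast hnorm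

/-- A number of vectors in `ℤ^m`, with entries of absolute value at most `Δ`, that suffices to
satisfy any satisfiable system of `m` inequalities. The Steinitz lemma, applied to vectors
centred at their mean, keeps the prefix sums within `2mΔ` of a line, in a cube with
`(4mΔ + 1)^m` integer points. -/
def steinitzBound (m Δ : ℕ) : ℕ := 2 * (4 * m * Δ + 1) ^ m

theorem steinitzBound_mono {m m' Δ Δ' : ℕ} (hm : m ≤ m') (hΔ : Δ ≤ Δ') :
    steinitzBound m Δ ≤ steinitzBound m' Δ' :=
  Nat.mul_le_mul_left 2 <| calc
    (4 * m * Δ + 1) ^ m ≤ (4 * m' * Δ' + 1) ^ m := by gcongr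
    _ ≤ (4 * m' * Δ' + 1) ^ m' := Nat.pow_le_pow_right (Nat.succ_pos _) hm

theorem abs_sub_ediv_le {p x n b : ℤ} (hn : 0 < n) (h : |n * p - x| ≤ n * b) :
    |p - x / n| ≤ b := by
  rw [abs_le] at h
  rw [abs_le, neg_le_sub_iff_le_add, sub_le_comm]
  constructor
  · exact Int.lt_add_one_iff.1 (Int.ediv_lt_of_lt_mul hn (by linarith))
  · exact (Int.le_ediv_iff_mul_le hn).2 (by linarith)

theorem exists_list_abs_prefix_sum_sub_le (hv : ∀ y ∈ A, ∀ i, |v y i| ≤ Δ) :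
    ∃ l : List Y, A.val = l ∧ ∀ k ≤ #A, ∀ i,
      |((l.take k).map (v · i)).sum - k * (∑ y ∈ A, v y i) / #A| ≤ 2 * Fintype.card ι * Δ := by
  set s : ι → ℤ := fun i => ∑ y ∈ A, v y i with hs
  have hcentred : ∀ y ∈ A, ∀ i, |#A * v y i - s i| ≤ (2 * #A * Δ : ℕ) := fun y hy i => by
    have hsi : |s i| ≤ #A * Δ := by
      simpa using (abs_sum_le_sum_abs _ A).trans (sum_le_card_nsmul A _ _ fun y hy => hv y hy i)
    refine (abs_sub _ _).trans ?_
    rw [abs_mul, Nat.abs_cast]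
    push_cast
    linarith [mul_le_mul_of_nonneg_left (hv y hy i) (Nat.cast_nonneg (α := ℤ) #A)]
  obtain ⟨l, hl, hpre⟩ := exists_list_abs_prefix_sum_le hcentred fun i => by
    simp [hs, sum_sub_distrib, mul_sum]
  have hlen : l.length = #A := by rw [card_def, hl, Multiset.coe_card]
  refine ⟨l, hl, fun k hk i => ?_⟩
  rcases Nat.eq_zero_or_pos #A with h0 | hpos
  · obtain rfl : k = 0 := by omega
    simp only [List.take_zero, List.map_nil, List.sum_nil, Nat.cast_zero, zero_mul, Int.zero_ediv,
      sub_zero, abs_zero]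
    positivity
  refine abs_sub_ediv_le (by exact_mod_cast hpos) ?_
  have hsum : ((l.take k).map fun y => #A * v y i - s i).sum =
      #A * ((l.take k).map (v · i)).sum - k * s i := by
    have hk' : (l.take k).length = k := by rw [List.length_take, hlen, min_eq_left hk]
    simp only [← Multiset.sum_coe, ← Multiset.map_coe, Multiset.sum_map_sub,
      Multiset.sum_map_mul_left, Multiset.map_const', Multiset.sum_replicate, Multiset.coe_card,
      hk', nsmul_eq_mul]
  have hle := hpre _ (l.take_prefix k) i
  rw [hsum] at hle
  push_cast at hle
  linarith

theorem exists_lt_map_eq_of_abs_le {N B : ℕ} (c : ℕ → ι → ℤ) (p : ℕ → Prop)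
    (hc : ∀ k ≤ N, ∀ i, |c k i| ≤ B) (hN : 2 * (2 * B + 1) ^ Fintype.card ι ≤ N) :
    ∃ j k, j < k ∧ k ≤ N ∧ c j = c k ∧ (p j ↔ p k) := by
  classical
  let palette : Finset ((ι → ℤ) × Prop) := Fintype.piFinset (fun _ => Icc (-B : ℤ) B) ×ˢ univ
  have hpalette : #palette < #(range (N + 1)) := by
    have hB : ((B : ℤ) + 1 - -B).toNat = 2 * B + 1 := by omega
    rw [card_product, Fintype.card_piFinset, prod_const, Int.card_Icc, hB, card_univ, card_univ,
      Fintype.card_prop, card_range]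
    omega
  obtain ⟨j, hj, k, hk, hne, hcol⟩ := exists_ne_map_eq_of_card_lt_of_maps_to hpalette
    (f := fun k => (c k, p k)) fun k hk => mem_product.2 ⟨Fintype.mem_piFinset.2 fun i =>
      mem_Icc.2 <| abs_le.1 (hc k (mem_range_succ_iff.1 hk) i), mem_univ _⟩
  rw [Prod.mk.injEq, eq_iff_iff] at hcol
  rcases hne.lt_or_gt with hjk | hkj
  · exact ⟨j, k, hjk, mem_range_succ_iff.1 hk, hcol⟩
  · exact ⟨k, j, hkj, mem_range_succ_iff.1 hj, hcol.1.symm, hcol.2.symm⟩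

theorem exists_nonempty_subset_sum_le (hv : ∀ y ∈ A, ∀ i, |v y i| ≤ Δ)
    (hsum : ∀ i, 0 ≤ ∑ y ∈ A, v y i)
    (hA : steinitzBound (Fintype.card ι) Δ ≤ #A) (a : Y) :
    ∃ U ⊆ A, U.Nonempty ∧ a ∉ U ∧ ∀ i, ∑ y ∈ U, v y i ≤ ∑ y ∈ A, v y i := by
  classical
  obtain ⟨l, hl, hpre⟩ := exists_list_abs_prefix_sum_sub_le hv
  have hnodup : l.Nodup := by
    rw [← Multiset.coe_nodup, ← hl]
    exact A.nodup
  have hlen : l.length = #A := by rw [card_def, hl, Multiset.coe_card]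
  obtain ⟨j, k, hjk, hkA, hsum_eq, ha_iff⟩ := exists_lt_map_eq_of_abs_le (N := #A)
    (B := 2 * Fintype.card ι * Δ)
    (fun k i => ((l.take k).map (v · i)).sum - k * (∑ y ∈ A, v y i) / #A) (a ∈ l.take ·)
    (by exact_mod_cast hpre) (by convert hA using 1; rw [steinitzBound]; ring_nf)
  set block := (l.take k).drop j
  have htake : l.take k = l.take j ++ block := by
    rw [← List.take_append_drop j (l.take k), List.take_take, min_eq_left hjk.le]
  have hblock : (l.take j ++ block).Nodup := htake ▸ (l.take_sublist k).nodup hnodup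
  refine ⟨block.toFinset, fun y hy => ?_, ?_, fun ha => ?_, fun i => ?_⟩
  · rw [← mem_val, hl]
    exact List.mem_of_mem_take (List.mem_of_mem_drop (List.mem_toFinset.1 hy))
  · rw [List.toFinset_nonempty_iff, ← List.length_pos_iff_ne_nil]
    simp only [block, List.length_drop, List.length_take]
    omega
  · have ha : a ∈ block := List.mem_toFinset.1 ha
    have haj : a ∈ l.take j := ha_iff.2 (htake ▸ List.mem_append_right _ ha)
    exact List.disjoint_of_nodup_append hblock haj ha
  · have hi := congrFun hsum_eq i
    simp only [htake, List.map_append, List.sum_append] at hi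
    rw [List.sum_toFinset _ (List.nodup_append.1 hblock).2.1]
    have hj0 : 0 ≤ j * (∑ y ∈ A, v y i) / #A :=
      Int.ediv_nonneg (mul_nonneg j.cast_nonneg (hsum i)) (Nat.cast_nonneg _)
    have hk0 : k * (∑ y ∈ A, v y i) / #A ≤ ∑ y ∈ A, v y i :=
      Int.ediv_le_of_le_mul (by exact_mod_cast (by omega : 0 < #A)) <| by
        rw [mul_comm]
        exact mul_le_mul_of_nonneg_left (by exact_mod_cast hkA) (hsum i)
    linarith

theorem exists_subset_card_lt {b : ι → ℤ} (hv : ∀ y ∈ A, ∀ i, |v y i| ≤ Δ) (hb : ∀ i, |b i| ≤ Δ)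
    (hsum : ∀ i, b i ≤ ∑ y ∈ A, v y i) :
    ∃ S ⊆ A, (∀ i, b i ≤ ∑ y ∈ S, v y i) ∧
      #S < steinitzBound (Fintype.card ι) Δ := by
  classical
  obtain ⟨S, hSA, hS⟩ :=
    exists_minimal_le_of_wellFoundedLT (fun S => ∀ i, b i ≤ ∑ y ∈ S, v y i) A hsum
  refine ⟨S, hSA, hS.prop, ?_⟩
  by_contra! hcard
  let w : Option Y → ι → ℤ := fun o i => o.elim (-b i) (v · i)
  have hw : ∀ i, ∑ o ∈ insertNone S, w o i = -b i + ∑ y ∈ S, v y i := fun i => by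
    rw [sum_insertNone]
    rfl
  obtain ⟨U, hUS, hU, hnone, hUle⟩ :=
    exists_nonempty_subset_sum_le (A := insertNone S) (v := w) (Δ := Δ)
      (forall_mem_insertNone.2 ⟨fun i => by simpa [w] using hb i, fun y hy => hv y (hSA hy)⟩)
      (fun i => by linarith [hw i, hS.prop i]) (hcard.trans (by simp)) none
  obtain ⟨V, rfl⟩ : ∃ V : Finset Y, U = V.map .some :=
    ⟨eraseNone U, by rw [map_some_eraseNone, erase_eq_of_notMem hnone]⟩
  have hVS : V ⊆ S := fun y hy => some_mem_insertNone.1 (hUS (mem_map_of_mem _ hy))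
  have hdiff : ∀ i, b i ≤ ∑ y ∈ S \ V, v y i := fun i => by
    have hV := hUle i
    rw [hw, sum_map] at hV
    simp only [w, Function.Embedding.some_apply, Option.elim_some] at hV
    linarith [sum_sdiff (f := (v · i)) hVS]
  exact (sdiff_ssubset hVS (map_nonempty.1 hU)).not_ge (hS.le_of_le hdiff sdiff_subset)

end SmallSubset

namespace DLConcept

variable {α ρ : Type*}

/-- A bound for the coefficients, and for the differences between the right-hand side and a
coefficient, of the linear inequality that expresses a concept. It is positive only for the
concepts `∃ R.C`, `≥ n R.C` and the part restrictions. -/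
def coeffBound : DLConcept α ρ → ℕ
  | ex _ _ => 1
  | atLeast n _ _ => n + 1
  | more r _ _ => r.den + 1
  | weak r _ _ => r.den + 1
  | _ => 0

/-- The right-hand side of the linear inequality, in the contributions of the neighbours of a
node, that expresses a concept `∃ R.C`, `≥ n R.C`, `M r R.C` or `W r R.C`. -/
def demand : DLConcept α ρ → ℤ
  | ex _ _ => 1
  | atLeast n _ _ => n
  | more _ _ _ => 1
  | _ => 0

theorem IsPart.coeffBound_pos {C : DLConcept α ρ} (h : C.IsPart) : 0 < C.coeffBound := by
  obtain ⟨R, r, E, rfl | rfl⟩ := h <;> exact Nat.succ_pos _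

theorem IsAtLeast.coeffBound_pos {C : DLConcept α ρ} (h : C.IsAtLeast) : 0 < C.coeffBound := by
  obtain ⟨R, E, rfl⟩ | ⟨n, R, E, rfl⟩ := h <;> exact Nat.succ_pos _

end DLConcept

namespace LTree

variable {α ρ : Type*} {H : RoleBox ρ} {T : LTree α ρ} {R : Role ρ} {C : DLConcept α ρ}
  {x y : List ℕ}

theorem mem_nbrs :
    y ∈ T.nbrs H R x ↔ y ∈ T.nodes ∧ (T.IsRSucc H R x y ∨ T.IsRSucc H R.Inv y x) := by
  classical
  exact Finset.mem_filter

theorem mem_nbrsWith : y ∈ T.nbrsWith H R x C ↔ y ∈ T.nbrs H R x ∧ C ∈ T.label y := by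
  classical
  exact Finset.mem_filter

theorem nbrsWith_subset_nbrs : T.nbrsWith H R x C ⊆ T.nbrs H R x := fun _ hy =>
  (mem_nbrsWith.1 hy).1

open Classical in
/-- The set of successors of `x`. -/
noncomputable def succs (T : LTree α ρ) (x : List ℕ) : Finset (List ℕ) :=
  T.nodes.filter (T.IsSucc x)

theorem mem_succs : y ∈ T.succs x ↔ y ∈ T.nodes ∧ ∃ i, y = i :: x := by
  classical
  exact Finset.mem_filter.trans (and_iff_right_of_imp And.left)

theorem tail_notMem_succs : x.tail ∉ T.succs x := fun h => by
  obtain ⟨-, i, hi⟩ := mem_succs.1 h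
  have := congrArg List.length hi
  simp only [List.length_tail, List.length_cons] at this
  omega

theorem nbrs_subset_insert_succs : T.nbrs H R x ⊆ insert x.tail (T.succs x) := by
  intro y hy
  rcases (mem_nbrs.1 hy).2 with ⟨hy, -⟩ | ⟨⟨-, i, rfl⟩, -⟩
  · exact Finset.mem_insert_of_mem (mem_succs.2 hy)
  · exact Finset.mem_insert_self _ _

theorem sum_ite_mem_eq_card {K : Finset (List ℕ)} (hK : K ⊆ T.nbrs H R x) :
    ∑ y ∈ insert x.tail (T.succs x), (if y ∈ K then (1 : ℤ) else 0) = K.card := by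
  rw [Finset.sum_ite_mem, Finset.inter_eq_right.2 (hK.trans nbrs_subset_insert_succs)]
  simp

section Balance

variable [Inhabited α]

/-- The contribution of `y` to the left-hand side of the linear inequality that expresses `C`
at `x`: for `M r R.C` with `r = p / q`, for instance, the inequality `♯R(x, C) > r ♯R(x)` becomes
`q ♯R(x, C) - p ♯R(x) ≥ 1`. -/
noncomputable def weight (H : RoleBox ρ) (T : LTree α ρ) (x y : List ℕ) : DLConcept α ρ → ℤ
  | .ex R C => if y ∈ T.nbrsWith H R x C then 1 else 0
  | .atLeast _ R C => if y ∈ T.nbrsWith H R x C then 1 else 0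
  | .more r R C => r.den * (if y ∈ T.nbrsWith H R x C then 1 else 0) -
      r.num * if y ∈ T.nbrs H R x then 1 else 0
  | .weak r R C => r.num * (if y ∈ T.nbrs H R x then 1 else 0) -
      r.den * if y ∈ T.nbrsWith H R x C.compl then 1 else 0
  | _ => 0

/-- The left-hand side of the linear inequality that expresses `C` at `x`. Besides successors,
only the predecessor `x.tail` can be a neighbour of `x`. (For the root, `x.tail = x` contributes
nothing.) -/
noncomputable def balance (H : RoleBox ρ) (T : LTree α ρ) (x : List ℕ) (C : DLConcept α ρ) : ℤ :=
  ∑ y ∈ insert x.tail (T.succs x), T.weight H x y C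

theorem abs_weight_le (hC : C.WF H) :
    |T.weight H x y C| ≤ C.coeffBound ∧ |C.demand - T.weight H x y C| ≤ C.coeffBound := by
  have hnum : ∀ r : ℚ, 0 < r → r < 1 → 0 < r.num ∧ r.num < r.den := fun r h0 h1 =>
    ⟨Rat.num_pos.2 h0, Rat.num_lt_denom_iff.2 h1⟩
  rw [abs_le, abs_le]
  cases C with
  | more r R E | weak r R E =>
    have := hnum r hC.1 hC.2.1
    simp only [weight, DLConcept.coeffBound, DLConcept.demand]
    split_ifs <;> push_cast <;> omega
  | _ =>
    simp only [weight, DLConcept.coeffBound, DLConcept.demand]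
    try split_ifs
    all_goals omega

theorem demand_le_balance_iff :
    C.demand ≤ T.balance H x C ↔ ¬ T.PartClash H x C ∧ ¬ T.AtLeastLacking H x C := by
  have hq : ∀ (r : ℚ) (a b : ℕ), (a : ℚ) ≤ r * b ↔ (r.den : ℤ) * a ≤ r.num * b := fun r a b => by
    have hd : (0 : ℚ) < r.den := by exact_mod_cast r.den_pos
    rw [← mul_le_mul_iff_right₀ hd, ← mul_assoc, mul_comm (r.den : ℚ) r, Rat.mul_den_eq_num]
    exact_mod_cast Iff.rfl
  cases C with
  | ex R E =>
    simp only [balance, weight, sum_ite_mem_eq_card nbrsWith_subset_nbrs, DLConcept.demand,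
      PartClash, AtLeastLacking, not_false_eq_true, true_and]
    rw [← Finset.card_eq_zero]
    omega
  | atLeast n R E =>
    simp only [balance, weight, sum_ite_mem_eq_card nbrsWith_subset_nbrs, DLConcept.demand,
      PartClash, AtLeastLacking, not_false_eq_true, true_and]
    omega
  | more r R E =>
    simp only [balance, weight, Finset.sum_sub_distrib, ← Finset.mul_sum,
      sum_ite_mem_eq_card nbrsWith_subset_nbrs, sum_ite_mem_eq_card subset_rfl, DLConcept.demand,
      PartClash, AtLeastLacking, not_false_eq_true, and_true, hq]
    omega
  | weak r R E =>
    simp only [balance, weight, Finset.sum_sub_distrib, ← Finset.mul_sum,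
      sum_ite_mem_eq_card nbrsWith_subset_nbrs, sum_ite_mem_eq_card subset_rfl, DLConcept.demand,
      PartClash, AtLeastLacking, not_false_eq_true, and_true, ← not_le, hq]
    omega
  | _ => simp [balance, weight, DLConcept.demand, PartClash, AtLeastLacking]

end Balance

variable {S : Finset (List ℕ)} {z : List ℕ}

open Classical in
/-- The tree obtained from `T` by deleting the successors of `x` that are not in `S`, together
with the subtrees below them. -/
noncomputable def prune (T : LTree α ρ) (x : List ℕ) (S : Finset (List ℕ)) : LTree α ρ where
  nodes := T.nodes.filter fun z => ∀ i, i :: x <:+ z → i :: x ∈ S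
  root_mem := Finset.mem_filter.2 ⟨T.root_mem, fun i hi => by simp at hi⟩
  pred_mem i z hz := by
    rw [Finset.mem_filter] at hz ⊢
    exact ⟨T.pred_mem i z hz.1, fun j hj => hz.2 j (hj.trans (List.suffix_cons i z))⟩
  label := T.label
  edge := T.edge

theorem mem_prune_nodes :
    z ∈ (T.prune x S).nodes ↔ z ∈ T.nodes ∧ ∀ i, i :: x <:+ z → i :: x ∈ S := by
  classical
  exact Finset.mem_filter

theorem prune_nodes_subset : (T.prune x S).nodes ⊆ T.nodes := fun _ h =>
  (mem_prune_nodes.1 h).1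

theorem mem_prune_nodes_of_agree (hz : x <:+ z → z = x) :
    z ∈ (T.prune x S).nodes ↔ z ∈ T.nodes := by
  refine mem_prune_nodes.trans (and_iff_left fun i hi => ?_)
  obtain rfl := hz ((List.suffix_cons i x).trans hi)
  exact absurd hi.length_le (by simp)

theorem cons_mem_prune_nodes {i : ℕ} :
    i :: x ∈ (T.prune x S).nodes ↔ i :: x ∈ T.nodes ∧ i :: x ∈ S := by
  refine mem_prune_nodes.trans (and_congr_right fun _ => ⟨fun h => h i List.suffix_rfl, ?_⟩)
  intro h j hj
  rwa [hj.eq_of_length (by simp)]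

theorem succs_prune (hS : S ⊆ T.succs x) : (T.prune x S).succs x = S := by
  ext y
  rw [mem_succs]
  constructor
  · rintro ⟨hy, i, rfl⟩
    exact (cons_mem_prune_nodes.1 hy).2
  · intro hy
    obtain ⟨hyT, i, rfl⟩ := mem_succs.1 (hS hy)
    exact ⟨cons_mem_prune_nodes.2 ⟨hyT, hy⟩, i, rfl⟩

theorem tail_mem_nodes (hx : x ∈ T.nodes) : x.tail ∈ T.nodes := by
  cases x with
  | nil => exact hx
  | cons i u => exact T.pred_mem i u hx

theorem mem_prune_nbrs_iff (hy : y ∈ (T.prune x S).nodes) (hz : z ∈ (T.prune x S).nodes) :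
    y ∈ (T.prune x S).nbrs H R z ↔ y ∈ T.nbrs H R z := by
  have hrs : ∀ {R u v}, v ∈ (T.prune x S).nodes →
      ((T.prune x S).IsRSucc H R u v ↔ T.IsRSucc H R u v) := fun hv =>
    and_congr_left fun _ => and_congr_left fun _ => iff_of_true hv (prune_nodes_subset hv)
  rw [mem_nbrs, mem_nbrs, hrs hy, hrs hz]
  exact and_congr_left fun _ => iff_of_true hy (prune_nodes_subset hy)

theorem mem_prune_nbrsWith_iff (hy : y ∈ (T.prune x S).nodes) (hz : z ∈ (T.prune x S).nodes) :
    y ∈ (T.prune x S).nbrsWith H R z C ↔ y ∈ T.nbrsWith H R z C := by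
  rw [mem_nbrsWith, mem_nbrsWith, mem_prune_nbrs_iff hy hz]
  rfl

theorem prune_nbrs_subset : (T.prune x S).nbrs H R z ⊆ T.nbrs H R z := by
  intro y hy
  obtain ⟨hyn, hys⟩ := mem_nbrs.1 hy
  exact mem_nbrs.2 ⟨prune_nodes_subset hyn,
    hys.imp (.imp_left (.imp_left (prune_nodes_subset ·)))
      (.imp_left (.imp_left (prune_nodes_subset ·)))⟩

theorem prune_nbrsWith_subset : (T.prune x S).nbrsWith H R z C ⊆ T.nbrsWith H R z C := by
  classical
  exact Finset.filter_subset_filter _ prune_nbrs_subset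

theorem AtMostClash.of_prune (h : (T.prune x S).AtMostClash H z) : T.AtMostClash H z := by
  obtain ⟨n, R, C, hm, hn⟩ := h
  exact ⟨n, R, C, hm, hn.trans_le (Finset.card_le_card prune_nbrsWith_subset)⟩

theorem AtMostApplicable.atMostClash (h : T.AtMostApplicable H z) : T.AtMostClash H z := by
  obtain ⟨_, n, R, C, hm, hn, _⟩ := h
  exact ⟨n, R, C, hm, hn⟩

theorem blocked_prune : ∀ z, (T.prune x S).Blocked z ↔ T.Blocked z
  | [] => Iff.rfl
  | _ :: u => or_congr (blocked_prune u) Iff.rfl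

theorem indirectlyBlocked_prune : ∀ z, (T.prune x S).IndirectlyBlocked z ↔ T.IndirectlyBlocked z
  | [] => Iff.rfl
  | _ :: u => or_congr (blocked_prune u) Iff.rfl

theorem card_prune_nbrs_le (hS : S ⊆ T.succs x) :
    ((T.prune x S).nbrs H R x).card ≤ S.card + 1 :=
  calc ((T.prune x S).nbrs H R x).card
      ≤ (insert x.tail ((T.prune x S).succs x)).card :=
        Finset.card_le_card nbrs_subset_insert_succs
    _ ≤ S.card + 1 := by rw [succs_prune hS]; exact Finset.card_insert_le _ _

variable [Inhabited α]

theorem weight_prune (hx : x ∈ (T.prune x S).nodes) (hy : y ∈ (T.prune x S).nodes) :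
    (T.prune x S).weight H x y C = T.weight H x y C := by
  cases C <;> simp only [weight, mem_prune_nbrs_iff hy hx, mem_prune_nbrsWith_iff hy hx]

theorem balance_prune (hS : S ⊆ T.succs x) (hx : x ∈ T.nodes) :
    (T.prune x S).balance H x C = ∑ y ∈ insert x.tail S, T.weight H x y C := by
  have hx' : x ∈ (T.prune x S).nodes := (mem_prune_nodes_of_agree fun _ => rfl).2 hx
  rw [balance, succs_prune hS]
  refine Finset.sum_congr rfl fun y hy => weight_prune hx' ?_
  rcases Finset.mem_insert.1 hy with rfl | hy
  · exact tail_mem_nodes hx'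
  · rw [← succs_prune hS] at hy
    exact (mem_succs.1 hy).1

theorem NonGeneratingDone.prune (h : T.NonGeneratingDone H z) (hc : ¬ T.AtMostClash H z) :
    (T.prune x S).NonGeneratingDone H z := by
  obtain ⟨h1, h2, h3, h4, h5, _⟩ := h
  have hb := mt (indirectlyBlocked_prune (T := T) (S := S) (x := x) z).2
  refine ⟨fun h => h1 (h.imp_left hb), fun h => h2 (h.imp_left hb), ?_, ?_, ?_,
    fun h => hc h.atMostClash.of_prune⟩
  · rintro ⟨hi, R, C, hm, y, hy, hC⟩
    exact h3 ⟨hb hi, R, C, hm, y, prune_nbrs_subset hy, hC⟩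
  · rintro ⟨hi, R, R', C, hm, ht, hs, y, hy, hC⟩
    exact h4 ⟨hb hi, R, R', C, hm, ht, hs, y, prune_nbrs_subset hy, hC⟩
  · rintro ⟨hi, R, C, hm, y, hy, hC⟩
    exact h5 ⟨hb hi, R, C, hm, y, prune_nbrs_subset hy, hC⟩

variable {D : DLConcept α ρ} {T₀ : LTree α ρ} {P G : Set (DLConcept α ρ)}

theorem Satisfies.prune (h : Satisfies H D T₀ x P G T) (hS : S ⊆ T.succs x) (hx : x ∈ T.nodes)
    (hb : ∀ C, C ∈ P ∨ C ∈ G → C.demand ≤ ∑ y ∈ insert x.tail S, T.weight H x y C) :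
    Satisfies H D T₀ x P G (T.prune x S) := by
  obtain ⟨⟨hD, hlab, hedge⟩, hag, hdone, -, -⟩ := h
  have hsat : ∀ C, C ∈ P ∨ C ∈ G →
      ¬ (T.prune x S).PartClash H x C ∧ ¬ (T.prune x S).AtLeastLacking H x C := fun C hC =>
    demand_le_balance_iff.1 ((hb C hC).trans_eq (balance_prune hS hx).symm)
  refine ⟨⟨hD, fun z hz => hlab z (prune_nodes_subset hz),
    fun i z hz => hedge i z (prune_nodes_subset hz)⟩, fun z hz => ?_, fun z hz hxz => ?_,
    fun C hC => (hsat C (Or.inl hC)).1, fun C hC => (hsat C (Or.inr hC)).2⟩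
  · exact ⟨(mem_prune_nodes_of_agree hz).trans (hag z hz).1, (hag z hz).2⟩
  · obtain ⟨h1, h2, h3⟩ := hdone z (prune_nodes_subset hz) hxz
    exact ⟨h1.prune h3, h2, fun h => h3 h.of_prune⟩

theorem Satisfies.demand_le_balance (h : Satisfies H D T₀ x P G T) (hP : ∀ C ∈ P, C.IsPart)
    (hG : ∀ C ∈ G, C.IsAtLeast) (hC : C ∈ P ∨ C ∈ G) : C.demand ≤ T.balance H x C := by
  obtain ⟨-, -, -, hpart, hleast⟩ := h
  rw [demand_le_balance_iff]
  rcases hC with hC | hC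
  · refine ⟨hpart C hC, ?_⟩
    obtain ⟨R, r, E, rfl | rfl⟩ := hP C hC <;> exact id
  · refine ⟨?_, hleast C hC⟩
    obtain ⟨R, E, rfl⟩ | ⟨n, R, E, rfl⟩ := hG C hC <;> exact id

theorem Satisfies.exists_card_nbrs_le (h : Satisfies H D T₀ x P G T) (hx : x ∈ T.nodes)
    {L : Finset (DLConcept α ρ)} (hL : ∀ C ∈ L, C.WF H) (hP : ∀ C ∈ P, C ∈ L ∧ C.IsPart)
    (hG : ∀ C ∈ G, C ∈ L ∧ C.IsAtLeast) {Δ : ℕ} (hΔ : ∀ C ∈ L, C.coeffBound ≤ Δ) :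
    ∃ T', Satisfies H D T₀ x P G T' ∧ ∀ R, (T'.nbrs H R x).card ≤
      steinitzBound (L.filter fun C => 0 < C.coeffBound).card Δ := by
  classical
  let A := L.filter fun C => C ∈ P ∨ C ∈ G
  have hAP : ∀ C, C ∈ A ↔ C ∈ P ∨ C ∈ G := fun C =>
    Finset.mem_filter.trans (and_iff_right_of_imp (Or.rec (hP C · |>.1) (hG C · |>.1)))
  have hbound : ∀ (C : A) y,
      |T.weight H x y C.1| ≤ Δ ∧ |C.1.demand - T.weight H x y C.1| ≤ Δ := fun C y => by
    have hCL := (Finset.mem_filter.1 C.2).1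
    have hCΔ : (C.1.coeffBound : ℤ) ≤ Δ := mod_cast hΔ C hCL
    exact (abs_weight_le (hL C hCL)).imp (·.trans hCΔ) (·.trans hCΔ)
  obtain ⟨S, hS, hSb, hcard⟩ := exists_subset_card_lt (A := T.succs x)
    (v := fun y (C : A) => T.weight H x y C) (b := fun C => C.1.demand - T.weight H x x.tail C)
    (fun y _ C => (hbound C y).1) (fun C => (hbound C _).2) fun C => by
      rw [sub_le_iff_le_add', ← Finset.sum_insert (f := (T.weight H x · C.1)) tail_notMem_succs]
      exact h.demand_le_balance (fun C hC => (hP C hC).2) (fun C hC => (hG C hC).2)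
        ((hAP C).1 C.2)
  refine ⟨T.prune x S, h.prune hS hx fun C hC => ?_, fun R => ?_⟩
  · rw [Finset.sum_insert fun h => tail_notMem_succs (hS h), ← sub_le_iff_le_add']
    exact hSb ⟨C, (hAP C).2 hC⟩
  · calc ((T.prune x S).nbrs H R x).card ≤ S.card + 1 := card_prune_nbrs_le hS
      _ ≤ steinitzBound A.card Δ := by rwa [Fintype.card_coe] at hcard
      _ ≤ steinitzBound (L.filter fun C => 0 < C.coeffBound).card Δ := by
        refine steinitzBound_mono (Finset.card_le_card fun C hC => ?_) le_rfl
        exact Finset.mem_filter.2 ⟨(Finset.mem_filter.1 hC).1, ((hAP C).1 hC).elim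
          (fun h => (hP C h).2.coeffBound_pos) fun h => (hG C h).2.coeffBound_pos⟩

end LTree

theorem Role.one_le_length {ρ : Type*} (R : Role ρ) : 1 ≤ R.length := by
  cases R <;> simp [Role.length]

namespace DLConcept

variable {α ρ : Type*} {H : RoleBox ρ} {C D E : DLConcept α ρ}

/-- The list of all sub-concepts, one entry for each occurrence. -/
def subs : DLConcept α ρ → List (DLConcept α ρ)
  | atom A => [atom A]
  | neg C => neg C :: C.subs
  | and C E => and C E :: (C.subs ++ E.subs)
  | or C E => or C E :: (C.subs ++ E.subs)
  | all R C => all R C :: C.subs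
  | ex R C => ex R C :: C.subs
  | atLeast n R C => atLeast n R C :: C.subs
  | atMost n R C => atMost n R C :: C.subs
  | more r R C => more r R C :: C.subs
  | weak r R C => weak r R C :: C.subs

/-- The number of symbols of the outermost constructor, without those of the immediate
sub-concepts. -/
def headLength : DLConcept α ρ → ℕ
  | atom _ | neg _ | and _ _ | or _ _ => 1
  | all R _ => 1 + R.length
  | ex R _ => 1 + R.length
  | atLeast n R _ => 1 + digits n + R.length
  | atMost n R _ => 1 + digits n + R.length
  | more r R _ => 1 + digits r.num.natAbs + digits r.den + R.length
  | weak r R _ => 1 + digits r.num.natAbs + digits r.den + R.length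

theorem sum_headLength_subs : (D.subs.map headLength).sum = D.length := by
  induction D <;> simp_all [subs, headLength, length] <;> omega

theorem headLength_le_of_mem_subs (h : E ∈ D.subs) : E.headLength ≤ D.length :=
  sum_headLength_subs (D := D) ▸ List.le_sum_of_mem (List.mem_map_of_mem h)

theorem one_le_length (D : DLConcept α ρ) : 1 ≤ D.length := by
  cases D <;> simp only [length] <;> omega

theorem self_mem_subs (D : DLConcept α ρ) : D ∈ D.subs := by
  cases D <;> simp [subs]

theorem mem_subs_of_immSub (h : E ∈ D.subs) (hC : C ∈ E.immSub) : C ∈ D.subs := by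
  induction D with
  | atom A =>
    obtain rfl : E = atom A := by simpa [subs] using h
    exact hC.elim
  | and D₁ D₂ ih₁ ih₂ | or D₁ D₂ ih₁ ih₂ =>
    simp only [subs, List.mem_cons, List.mem_append] at h ⊢
    rcases h with rfl | h | h
    · rcases hC with rfl | rfl
      · exact Or.inr (Or.inl (self_mem_subs _))
      · exact Or.inr (Or.inr (self_mem_subs _))
    · exact Or.inr (Or.inl (ih₁ h))
    · exact Or.inr (Or.inr (ih₂ h))
  | _ =>
    simp only [subs, List.mem_cons] at h ⊢
    rcases h with rfl | h
    · obtain rfl := hC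
      exact Or.inr (self_mem_subs _)
    · exact Or.inr (by solve_by_elim)

theorem IsNNF.eq_atom_of_neg (h : (neg C).IsNNF) : ∃ A, C = atom A := by
  cases C with
  | atom A => exact ⟨A, rfl⟩
  | _ => exact h.elim

theorem IsNNF.of_mem_subs (hD : D.IsNNF) (h : E ∈ D.subs) : E.IsNNF := by
  induction D with
  | atom A =>
    obtain rfl : E = atom A := by simpa [subs] using h
    exact hD
  | neg C ih =>
    obtain ⟨A, rfl⟩ := hD.eq_atom_of_neg
    simp only [subs, List.mem_cons, List.not_mem_nil, or_false] at h
    rcases h with rfl | rfl <;> trivial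
  | and D₁ D₂ ih₁ ih₂ | or D₁ D₂ ih₁ ih₂ =>
    simp only [subs, List.mem_cons, List.mem_append] at h
    rcases h with rfl | h | h
    exacts [hD, ih₁ hD.1 h, ih₂ hD.2 h]
  | _ =>
    simp only [subs, List.mem_cons] at h
    rcases h with rfl | h
    · exact hD
    · solve_by_elim

theorem WF.immSub (h : C.WF H) (hE : E ∈ C.immSub) : E.WF H := by
  cases C with
  | atom A => exact hE.elim
  | and _ _ | or _ _ =>
    rcases hE with rfl | rfl
    exacts [h.1, h.2]
  | neg _ | all _ _ | ex _ _ =>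
    obtain rfl := hE
    exact h
  | atLeast _ _ _ | atMost _ _ _ =>
    obtain rfl := hE
    exact h.2
  | more _ _ _ | weak _ _ _ =>
    obtain rfl := hE
    exact h.2.2.2

variable [Inhabited α]

theorem WF.nnf (h : C.WF H) (b : Bool) : (nnf b C).WF H := by
  induction C generalizing b with
  | atom A => cases b <;> trivial
  | neg C ih => cases b <;> exact ih h _
  | and _ _ ih₁ ih₂ | or _ _ ih₁ ih₂ => cases b <;> exact ⟨ih₁ h.1 _, ih₂ h.2 _⟩
  | all _ _ ih | ex _ _ ih => cases b <;> exact ih h _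
  | atLeast n R C ih =>
    cases b
    · cases n
      · exact ⟨trivial, trivial⟩
      · exact ⟨h.1, ih h.2 _⟩
    · exact ⟨h.1, ih h.2 _⟩
  | atMost n R C ih => cases b <;> exact ⟨h.1, ih h.2 _⟩
  | more _ _ _ ih | weak _ _ _ ih => cases b <;> exact ⟨h.1, h.2.1, h.2.2.1, ih h.2.2.2 _⟩

theorem Clos.wf (hD : D.WF H) (h : Clos D C) : C.WF H := by
  induction h with
  | self => exact hD
  | sub _ hE ih => exact ih.immSub hE
  | compl _ ih => exact ih.nnf false

theorem LabelConcept.wf (hD : D.WF H) (h : LabelConcept H D C) : C.WF H := by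
  rcases h with h | ⟨R, S, E, rfl, h, -⟩
  · exact h.wf hD
  · have hall : (all S E).WF H := h.wf hD
    exact hall

theorem IsNNF.nnf_true (h : C.IsNNF) : nnf true C = C := by
  induction C with
  | neg C ih =>
    obtain ⟨A, rfl⟩ := h.eq_atom_of_neg
    rfl
  | and _ _ ih₁ ih₂ | or _ _ ih₁ ih₂ => simp [nnf, ih₁ h.1, ih₂ h.2]
  | atom A => rfl
  | all _ _ ih | ex _ _ ih | atLeast _ _ _ ih | atMost _ _ _ ih | more _ _ _ ih
  | weak _ _ _ ih => simp [nnf, ih h]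

theorem IsNNF.compl_compl_compl (h : C.IsNNF) : C.compl.compl.compl = C.compl := by
  unfold compl
  induction C with
  | atom A => rfl
  | neg C ih =>
    obtain ⟨A, rfl⟩ := h.eq_atom_of_neg
    rfl
  | and _ _ ih₁ ih₂ | or _ _ ih₁ ih₂ => simp [nnf, ih₁ h.1, ih₂ h.2]
  | atLeast n R C => cases n <;> simp [nnf, IsNNF.nnf_true (C := C) h]
  | atMost n R C => simp [nnf, IsNNF.nnf_true (C := C) h]
  | all R C ih | ex R C ih | more r R C ih | weak r R C ih => simp [nnf, ih h]

/-- The contradiction `A ⊓ ¬ A` replacing `¬ ≥ 0 R.C`, its complement, and their sub-concepts. -/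
def IsTrivial (C : DLConcept α ρ) : Prop :=
  C = and (atom default) (neg (atom default)) ∨ C = or (neg (atom default)) (atom default) ∨
    C = atom default ∨ C = neg (atom default)

theorem IsTrivial.compl (h : C.IsTrivial) : C.compl.IsTrivial := by
  rcases h with rfl | rfl | rfl | rfl <;> simp [IsTrivial, DLConcept.compl, nnf]

theorem IsTrivial.immSub (h : C.IsTrivial) (hE : E ∈ C.immSub) : E.IsTrivial := by
  rcases h with rfl | rfl | rfl | rfl <;> simp_all [IsTrivial, DLConcept.immSub]
  tauto

theorem IsTrivial.coeffBound_eq_zero (h : C.IsTrivial) : C.coeffBound = 0 := by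
  rcases h with rfl | rfl | rfl | rfl <;> rfl

/-- The concepts `E`, `∼ E` and `∼ ∼ E`; the last one may differ from `E` if a concept `≥ 0 R.C`
occurs in `E`. Up to the trivial concepts, `clos(D)` consists of the variants of the sub-concepts
of `D`. -/
def variants (E : DLConcept α ρ) : List (DLConcept α ρ) := [E, E.compl, E.compl.compl]

theorem mem_variants : C ∈ E.variants ↔ C = E ∨ C = E.compl ∨ C = E.compl.compl := by
  simp [variants]

theorem IsNNF.compl_mem_variants (hE : E.IsNNF) (h : C ∈ E.variants) : C.compl ∈ E.variants := by
  rw [mem_variants] at *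
  rcases h with rfl | rfl | rfl
  exacts [Or.inr (Or.inl rfl), Or.inr (Or.inr rfl), Or.inr (Or.inl hE.compl_compl_compl)]

theorem IsNNF.immSub_of_mem_variants {V : DLConcept α ρ} (hE : E.IsNNF) (hV : V ∈ E.variants)
    (hC : C ∈ V.immSub) : C.IsTrivial ∨ C = E ∨ ∃ F ∈ E.immSub, C ∈ F.variants := by
  simp only [mem_variants, DLConcept.compl] at *
  cases E with
  | neg F =>
    obtain ⟨A, rfl⟩ := hE.eq_atom_of_neg
    rcases hV with rfl | rfl | rfl <;> simp_all [nnf, immSub]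
  | atLeast n R F =>
    have hF : nnf true F = F := IsNNF.nnf_true (C := F) hE
    cases n with
    | zero =>
      rcases hV with rfl | rfl | rfl
      · exact Or.inr (Or.inr ⟨C, hC, Or.inl rfl⟩)
      · exact Or.inl (IsTrivial.immSub (Or.inl rfl) hC)
      · exact Or.inl (IsTrivial.immSub (Or.inr (Or.inl rfl)) hC)
    | succ n => rcases hV with rfl | rfl | rfl <;> simp_all [nnf, immSub]
  | atMost n R F =>
    have hF : nnf true F = F := IsNNF.nnf_true (C := F) hE
    rcases hV with rfl | rfl | rfl <;> simp_all [nnf, immSub]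
  | and F G | or F G =>
    rcases hV with rfl | rfl | rfl <;> rcases hC with rfl | rfl <;> simp [immSub]
  | _ => rcases hV with rfl | rfl | rfl <;> simp_all [nnf, immSub]

theorem Clos.isTrivial_or_mem_variants (hD : D.IsNNF) (h : Clos D C) :
    C.IsTrivial ∨ ∃ E ∈ D.subs, C ∈ E.variants := by
  induction h with
  | self => exact Or.inr ⟨D, self_mem_subs D, mem_variants.2 (Or.inl rfl)⟩
  | sub _ hE ih =>
    rcases ih with ih | ⟨F, hF, hV⟩
    · exact Or.inl (ih.immSub hE)
    · rcases (hD.of_mem_subs hF).immSub_of_mem_variants hV hE with h | rfl | ⟨G, hG, h⟩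
      · exact Or.inl h
      · exact Or.inr ⟨_, hF, mem_variants.2 (Or.inl rfl)⟩
      · exact Or.inr ⟨G, mem_subs_of_immSub hF hG, h⟩
  | compl _ ih =>
    rcases ih with ih | ⟨F, hF, hV⟩
    · exact Or.inl ih.compl
    · exact Or.inr ⟨F, hF, (hD.of_mem_subs hF).compl_mem_variants hV⟩

theorem LabelConcept.exists_mem_variants (hD : D.IsNNF) (h : LabelConcept H D C)
    (hC : 0 < C.coeffBound) : ∃ E ∈ D.subs, C ∈ E.variants := by
  rcases h with h | ⟨R, S, E, rfl, -⟩
  · exact (h.isTrivial_or_mem_variants hD).resolve_left fun ht => hC.ne' ht.coeffBound_eq_zero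
  · exact absurd hC (lt_irrefl 0)

theorem coeffBound_le_of_mem_variants (hE : E.IsNNF) (hC : C ∈ E.variants) :
    C.coeffBound ≤ 2 ^ E.headLength := by
  have hdigits : ∀ n k, digits n + 1 ≤ k → 2 * (n + 1) ≤ 2 ^ k := fun n k hk =>
    calc 2 * (n + 1) ≤ 2 * 2 ^ n.size := Nat.mul_le_mul_left 2 (Nat.lt_size_self n)
      _ = 2 ^ (n.size + 1) := (pow_succ' 2 _).symm
      _ ≤ 2 ^ k :=
        Nat.pow_le_pow_right two_pos ((Nat.succ_le_succ (le_max_right 1 _)).trans hk)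
  rw [mem_variants, DLConcept.compl, DLConcept.compl] at hC
  cases E with
  | neg C =>
    obtain ⟨A, rfl⟩ := hE.eq_atom_of_neg
    rcases hC with rfl | rfl | rfl <;> simp [nnf, coeffBound]
  | all R F | ex R F =>
    rcases hC with rfl | rfl | rfl <;> simp [nnf, coeffBound, Nat.one_le_two_pow]
  | atLeast n R F =>
    have := hdigits n (atLeast n R F).headLength (by simp only [headLength]; omega)
    cases n <;> rcases hC with rfl | rfl | rfl <;> simp only [nnf, coeffBound] <;> omega
  | atMost n R F =>
    have := hdigits n (atMost n R F).headLength (by simp only [headLength]; omega)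
    rcases hC with rfl | rfl | rfl <;> simp only [nnf, coeffBound] <;> omega
  | more r R F =>
    have := hdigits r.den (more r R F).headLength (by simp only [headLength]; omega)
    rcases hC with rfl | rfl | rfl <;> simp only [nnf, coeffBound] <;> omega
  | weak r R F =>
    have := hdigits r.den (weak r R F).headLength (by simp only [headLength]; omega)
    rcases hC with rfl | rfl | rfl <;> simp only [nnf, coeffBound] <;> omega
  | _ => rcases hC with rfl | rfl | rfl <;> simp [nnf, coeffBound]

theorem LabelConcept.coeffBound_le (hD : D.IsNNF) (h : LabelConcept H D C) :
    C.coeffBound ≤ 2 ^ D.length := by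
  rcases C.coeffBound.eq_zero_or_pos with hC | hC
  · simp [hC]
  · obtain ⟨E, hE, hCE⟩ := h.exists_mem_variants hD hC
    exact (coeffBound_le_of_mem_variants (hD.of_mem_subs hE) hCE).trans
      (Nat.pow_le_pow_right two_pos (headLength_le_of_mem_subs hE))

theorem IsNNF.length_filter_variants_le (hE : E.IsNNF) :
    (E.variants.filter fun C => 0 < C.coeffBound).length ≤ E.headLength := by
  have h3 := List.length_filter_le (fun C => 0 < C.coeffBound) E.variants
  have hdigits : ∀ n, 1 ≤ digits n := fun n => le_max_left _ _
  cases E with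
  | neg C =>
    obtain ⟨A, rfl⟩ := hE.eq_atom_of_neg
    simp [variants, DLConcept.compl, nnf, coeffBound]
  | atom A | and C E | or C E => simp [variants, DLConcept.compl, nnf, coeffBound]
  | all R C | ex R C =>
    have := R.one_le_length
    exact le_trans (b := 2) (by simp [variants, DLConcept.compl, nnf, coeffBound])
      (by simp only [headLength]; omega)
  | atLeast n R C | atMost n R C =>
    have := hdigits n
    have := R.one_le_length
    exact h3.trans (by simp only [headLength, variants, List.length_cons, List.length_nil]; omega)
  | more r R C | weak r R C =>
    have := hdigits r.den
    have := R.one_le_length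
    exact h3.trans (by simp only [headLength, variants, List.length_cons, List.length_nil]; omega)

theorem card_filter_coeffBound_pos_le (hD : D.IsNNF) {L : Finset (DLConcept α ρ)}
    (hL : ∀ C ∈ L, LabelConcept H D C) : (L.filter fun C => 0 < C.coeffBound).card ≤ D.length := by
  classical
  let N := D.subs.flatMap fun E => E.variants.filter fun C => 0 < C.coeffBound
  calc (L.filter fun C => 0 < C.coeffBound).card
      ≤ N.toFinset.card := Finset.card_le_card fun C hC => by
        obtain ⟨hCL, hC⟩ := Finset.mem_filter.1 hC
        obtain ⟨E, hE, hCE⟩ := (hL C hCL).exists_mem_variants hD hC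
        exact List.mem_toFinset.2 (List.mem_flatMap.2
          ⟨E, hE, List.mem_filter.2 ⟨hCE, decide_eq_true hC⟩⟩)
    _ ≤ N.length := List.toFinset_card_le N
    _ ≤ (D.subs.map headLength).sum := by
        rw [List.length_flatMap]
        exact List.sum_le_sum fun E hE => (hD.of_mem_subs hE).length_filter_variants_le
    _ = D.length := sum_headLength_subs

end DLConcept

section Bound

variable {α ρ : Type*}

theorem steinitzBound_le {n m Δ : ℕ} (hn : 1 ≤ n) (hm : m ≤ n) (hΔ : Δ ≤ 2 ^ n) :
    steinitzBound m Δ ≤ (2 * n) ^ (2 * n) * 2 ^ (4 * n ^ 2 + 3 * n) := by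
  have hbase : 4 * n * 2 ^ n + 1 ≤ (2 * n) ^ 2 * 2 ^ (n + 1) :=
    calc 4 * n * 2 ^ n + 1 ≤ 8 * (n * 2 ^ n) := by
          have : 0 < n * 2 ^ n := by positivity
          linarith
      _ ≤ 8 * (n ^ 2 * 2 ^ n) := by gcongr; exact Nat.le_self_pow two_ne_zero n
      _ = (2 * n) ^ 2 * 2 ^ (n + 1) := by ring
  calc steinitzBound m Δ ≤ 2 * (4 * n * 2 ^ n + 1) ^ n := steinitzBound_mono hm hΔ
    _ ≤ 2 * ((2 * n) ^ 2 * 2 ^ (n + 1)) ^ n := by gcongr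
    _ = (2 * n) ^ (2 * n) * 2 ^ ((n + 1) * n + 1) := by
      rw [mul_pow, ← pow_mul, ← pow_mul, pow_succ 2 ((n + 1) * n)]
      ring
    _ ≤ (2 * n) ^ (2 * n) * 2 ^ (4 * n ^ 2 + 3 * n) :=
      Nat.mul_le_mul_left _ (Nat.pow_le_pow_right two_pos (by nlinarith))

/-- The bound `BAN` for the number of neighbours of a node labelled with `L`. -/
def labelBound (L : Finset (DLConcept α ρ)) : ℕ :=
  steinitzBound (L.filter fun C => 0 < C.coeffBound).card (L.sup DLConcept.coeffBound)

theorem one_le_labelBound (L : Finset (DLConcept α ρ)) : 1 ≤ labelBound L :=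
  Nat.mul_pos two_pos (Nat.pow_pos (Nat.succ_pos _))

theorem labelBound_le [Inhabited α] {H : RoleBox ρ} {D : DLConcept α ρ} (hD : D.IsNNF)
    {L : Finset (DLConcept α ρ)} (hL : ∀ C ∈ L, DLConcept.LabelConcept H D C) :
    labelBound L ≤ (2 * D.length) ^ (2 * D.length) * 2 ^ (4 * D.length ^ 2 + 3 * D.length) :=
  steinitzBound_le D.one_le_length (DLConcept.card_filter_coeffBound_pos_le hD hL)
    (Finset.sup_le fun C hC => (hL C hC).coeffBound_le hD)

/-- `DLConcept.coeffBound` in terms of the word that codes a concept. -/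
def wordCoeffBound (w : List ℕ) : ℕ :=
  if w.getD 0 0 = 5 then 1
  else if w.getD 0 0 = 6 then w.getD 1 0 + 1
  else if w.getD 0 0 = 8 then w.getD 2 0 + 1
  else if w.getD 0 0 = 9 then w.getD 2 0 + 1
  else 0

theorem primrec_wordCoeffBound : Primrec wordCoeffBound := by
  have hget : ∀ k, Primrec fun w : List ℕ => w.getD k 0 := fun k =>
    (Primrec.list_getD 0).comp Primrec.id (Primrec.const k)
  have heq : ∀ c, PrimrecPred fun w : List ℕ => w.getD 0 0 = c := fun c =>
    Primrec.eq.comp (hget 0) (Primrec.const c)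
  exact Primrec.ite (heq 5) (Primrec.const 1) <|
    Primrec.ite (heq 6) (Primrec.succ.comp (hget 1)) <|
    Primrec.ite (heq 8) (Primrec.succ.comp (hget 2)) <|
    Primrec.ite (heq 9) (Primrec.succ.comp (hget 2)) (Primrec.const 0)

theorem wordCoeffBound_code [Encodable α] [Encodable ρ] (C : DLConcept α ρ) :
    wordCoeffBound C.code = C.coeffBound := by
  cases C <;> simp [wordCoeffBound, DLConcept.code, DLConcept.coeffBound]

theorem primrec_steinitzBound : Primrec₂ steinitzBound := by
  have hpow : Primrec₂ fun a b : ℕ => a ^ b := Primrec₂.unpaired'.1 Nat.Primrec.pow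
  have hmul : Primrec₂ fun a b : ℕ => a * b := Primrec.nat_mul
  have hbase : Primrec fun p : ℕ × ℕ => 4 * p.1 * p.2 + 1 :=
    Primrec.succ.comp (hmul.comp (hmul.comp (Primrec.const 4) Primrec.fst) Primrec.snd)
  exact hmul.comp (Primrec.const 2) (hpow.comp hbase Primrec.fst)

/-- `labelBound` in terms of the words that code the concepts of a label. -/
def wordsBound (l : List (List ℕ)) : ℕ :=
  steinitzBound (l.filter fun w => 0 < wordCoeffBound w).length
    (l.foldr (fun w k => max (wordCoeffBound w) k) 0)

theorem primrec_wordsBound : Primrec wordsBound := by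
  have hcount : Primrec fun l : List (List ℕ) =>
      (l.filter fun w => 0 < wordCoeffBound w).length :=
    Primrec.list_length.comp
      (Primrec.listFilter (Primrec.nat_lt.comp (Primrec.const 0) primrec_wordCoeffBound))
  have hmax : Primrec fun l : List (List ℕ) => l.foldr (fun w k => max (wordCoeffBound w) k) 0 :=
    Primrec.list_foldr Primrec.id (Primrec.const 0)
      (Primrec.nat_max.comp (primrec_wordCoeffBound.comp (Primrec.fst.comp Primrec.snd))
        (Primrec.snd.comp Primrec.snd)).to₂
  exact primrec_steinitzBound.comp hcount hmax

theorem wordsBound_map_code [Encodable α] [Encodable ρ] {L : Finset (DLConcept α ρ)}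
    {l : List (DLConcept α ρ)} (h : L.val = l) :
    wordsBound (l.map DLConcept.code) = labelBound L := by
  simp only [wordsBound, labelBound, Finset.card, Finset.filter_val, Finset.sup_def, h,
    Multiset.filter_coe, Multiset.coe_card, Multiset.map_coe, Multiset.sup_coe, List.filter_map,
    List.length_map, List.foldr_map, Function.comp_def, wordCoeffBound_code]
  rfl

theorem labelComputable_labelBound [Encodable α] [Encodable ρ] :
    LabelComputable fun (L : Finset (DLConcept α ρ)) _ => labelBound L :=
  ⟨fun l _ => wordsBound l, (primrec_wordsBound.comp Primrec.fst).to_comp,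
    fun _ _ h => (wordsBound_map_code h).symm, fun _ _ _ _ h _ => (wordsBound_map_code h).symm⟩

end Bound

theorem lemma6_general {α ρ : Type*} [Encodable α] [Encodable ρ] [Inhabited α] :
    ∃ BAN : Finset (DLConcept α ρ) → ℕ, LabelComputable (fun L _ => BAN L) ∧
      ∀ (H : RoleBox ρ) (D : DLConcept α ρ), D.WF H → D.IsNNF →
      ∀ T : LTree α ρ, T.IsCompletionTree H D → ∀ x ∈ T.nodes,
        1 ≤ BAN (T.label x) ∧
        BAN (T.label x) ≤
          (2 * D.length) ^ (2 * D.length) * 2 ^ (4 * D.length ^ 2 + 3 * D.length) ∧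
        ∀ P G : Set (DLConcept α ρ),
          (∀ C ∈ P, C ∈ T.label x ∧ C.IsPart) →
          (∀ C ∈ G, C ∈ T.label x ∧ C.IsAtLeast) →
          LTree.SimSatisfiable H D T x P G →
          ∃ T' : LTree α ρ, LTree.Satisfies H D T x P G T' ∧
            ∀ R, (T'.nbrs H R x).card ≤ BAN (T.label x) := by
  refine ⟨labelBound, labelComputable_labelBound, fun H D hWF hNNF T hT x hx => ?_⟩
  have hlabel : ∀ C ∈ T.label x, DLConcept.LabelConcept H D C := hT.2.1 x hx
  refine ⟨one_le_labelBound _, labelBound_le hNNF hlabel, ?_⟩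
  rintro P G hP hG ⟨T', hT'⟩
  have hx' : x ∈ T'.nodes := (hT'.2.1 x fun _ => rfl).1.2 hx
  exact hT'.exists_card_nbrs_le hx' (fun C hC => (hlabel C hC).wf hWF) hP hG
    fun C hC => Finset.le_sup hC

theorem lemma6 {α ρ : Type*} [Encodable α] [Encodable ρ] [Inhabited α] :
    ∃ BAN : Finset (DLConcept α ρ) → Option (Finset (DLConcept α ρ)) → ℕ,
      LabelComputable BAN ∧
      ∀ (H : RoleBox ρ) (D : DLConcept α ρ), D.WF H → D.IsNNF →
      ∀ T : LTree α ρ, T.IsCompletionTree H D →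
      ∀ x ∈ T.nodes, T.NonGeneratingDone H x →
        1 ≤ BAN (T.label x) (T.predLabel x) ∧
        BAN (T.label x) (T.predLabel x) ≤
          (2 * D.length) ^ (2 * D.length) * 2 ^ (4 * D.length ^ 2 + 3 * D.length) ∧
        ∀ P G : Set (DLConcept α ρ),
          (∀ C ∈ P, C ∈ T.label x ∧ C.IsPart) →
          (∀ C ∈ G, C ∈ T.label x ∧ C.IsAtLeast) →
          LTree.SimSatisfiable H D T x P G →
          ∃ T' : LTree α ρ, LTree.Satisfies H D T x P G T' ∧
            ∀ C ∈ P, ∀ R, C.IsPartOn R →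
              (T'.nbrs H R x).card ≤ BAN (T.label x) (T.predLabel x) := by
  obtain ⟨BAN, hBAN, h⟩ := lemma6_general (α := α) (ρ := ρ)
  refine ⟨fun L _ => BAN L, hBAN, fun H D hWF hNNF T hT x hx _ => ?_⟩
  exact (h H D hWF hNNF T hT x hx).imp_right <| And.imp_right fun hBAN P G hP hG hPG =>
    (hBAN P G hP hG hPG).imp fun _ => And.imp_right fun hcard _ _ R _ => hcard R
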